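/- Let $\lambda$ be a regular cardinal and let $\mathcal{A}$ be a small category that is $\lambda$-complete and $\lambda$-cocomplete (it has all limits and colimits of diagrams with fewer than $\lambda$ arrows) and is not a preorder (some two objects of $\mathcal{A}$ have two distinct parallel morphisms between them). Let $i:\mathcal{A}\to \mathsf{Ind}_\lambda\mathcal{A}$ be the free completion of $\mathcal{A}$ under small $\lambda$-filtered colimits, i.e. the full subcategory of $\mathsf{Set}^{\mathcal{A}^{\circ}}$ on the small $\lambda$-filtered colimits of representables, and let $i^\sharp:\mathcal{A}\to\mathsf{Pro}_\lambda\mathcal{A}=(\mathsf{Ind}_\lambda(\mathcal{A}^{\circ}))^{\circ}$ be the dual completion. Then the right Kan extension $\mathsf{Ran}_i\, i$ and the left Kan extension $\mathsf{Lan}_{i^\sharp}\, i^\sharp$ exist, and the following two conditions cannot hold simultaneously: 1. the codensity monad $\mathsf{Ran}_i\, i:\mathsf{Ind}_\lambda\mathcal{A}\to\mathsf{Ind}_\lambda\mathcal{A}$ is $\lambda$-accessible, i.e. it preserves small $\lambda$-filtered colimits; 2. the density comonad $\mathsf{Lan}_{i^\sharp}\, i^\sharp:\mathsf{Pro}_\lambda\mathcal{A}\to\mathsf{Pro}_\lambda\mathcal{A}$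 preserves small $\lambda$-codirected limits. -/

import Mathlib

open CategoryTheory CategoryTheory.Limits

universe w v u v₁ v₂ u₁ u₂

namespace CodensityAccess

/-! ### `κ`-complete and `κ`-cocomplete categories -/

/-- A category is `κ`-complete if it has all limits of diagrams whose shape has fewer than `κ`
arrows. -/
def IsCardinalComplete (C : Type u) [Category.{v} C] (κ : Cardinal.{w}) : Prop :=
  ∀ (J : Type w) [SmallCategory J], HasCardinalLT (Arrow J) κ → HasLimitsOfShape J C

/-- A category is `κ`-cocomplete if it has all colimits of diagrams whose shape has fewer than `κ`
arrows. -/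
def IsCardinalCocomplete (C : Type u) [Category.{v} C] (κ : Cardinal.{w}) : Prop :=
  ∀ (J : Type w) [SmallCategory J], HasCardinalLT (Arrow J) κ → HasColimitsOfShape J C

/-! ### The completions `Ind_κ A` and `Pro_κ A` of a small category `A` -/

section Completions

variable (A : Type w) [SmallCategory A] (κ : Cardinal.{w}) [Fact κ.IsRegular]

/-- The presheaves on `A` which are small `κ`-filtered colimits of representable presheaves. -/
def isCardinalIndObject : ObjectProperty (Aᵒᵖ ⥤ Type w) := fun P =>
  ∃ (J : Type w) (_ : SmallCategory J) (_ : IsCardinalFiltered J κ) (F : J ⥤ A)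
    (ι : F ⋙ yoneda ⟶ (Functor.const J).obj P), Nonempty (IsColimit (Cocone.mk P ι))

theorem isCardinalIndObject_yoneda (X : A) : isCardinalIndObject A κ (yoneda.obj X) :=
  ⟨Discrete PUnit.{w + 1}, inferInstance, isCardinalFiltered_of_hasTerminal _ κ,
    (Functor.const _).obj X, { app := fun _ => 𝟙 _ },
    ⟨{ desc := fun s => s.ι.app ⟨PUnit.unit⟩
       fac := fun s j => Category.id_comp _
       uniq := fun s m hm => by
         have h := hm ⟨PUnit.unit⟩
         exact (Category.id_comp m).symm.trans h }⟩⟩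

/-- The free completion `Ind_κ A` of `A` under small `κ`-filtered colimits. -/
abbrev IndCompletion : Type (w + 1) := (isCardinalIndObject A κ).FullSubcategory

/-- The canonical (fully faithful) functor `A ⥤ Ind_κ A`. -/
def toInd : A ⥤ IndCompletion A κ :=
  (isCardinalIndObject A κ).lift yoneda (isCardinalIndObject_yoneda A κ)

/-- The free completion `Pro_κ A = (Ind_κ Aᵒᵖ)ᵒᵖ` of `A` under small `κ`-cofiltered limits. -/
abbrev ProCompletion : Type (w + 1) := (IndCompletion Aᵒᵖ κ)ᵒᵖ

/-- The canonical (fully faithful) functor `A ⥤ Pro_κ A`. -/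
def toPro : A ⥤ ProCompletion A κ := (toInd Aᵒᵖ κ).rightOp

end Completions

/-! ### Codensity monads and density comonads -/

section Kan

variable {A : Type u₁} [Category.{v₁} A] {B : Type u₂} [Category.{v₂} B] (F : A ⥤ B)

/-- The unit of the codensity monad of `F`, corresponding to the identity of `F` under the
universal property of the right Kan extension of `F` along itself. -/
noncomputable def codensityUnit [F.HasRightKanExtension F] : 𝟭 B ⟶ F.rightKanExtension F :=
  Functor.liftOfIsRightKanExtension _ (F.rightKanExtensionCounit F) (𝟭 B) F.rightUnitor.hom

/-- The multiplication of the codensity monad of `F`. If `T` is the right Kan extension of `F`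
along itself and `ε : F ⋙ T ⟶ F` its counit, it corresponds to the composition
`F ⋙ T ⋙ T ⟶ F ⋙ T ⟶ F` of two instances of `ε` under the universal property. -/
noncomputable def codensityMul [F.HasRightKanExtension F] :
    F.rightKanExtension F ⋙ F.rightKanExtension F ⟶ F.rightKanExtension F :=
  Functor.liftOfIsRightKanExtension _ (F.rightKanExtensionCounit F) _
    ((Functor.associator _ _ _).inv ≫
      Functor.whiskerRight (F.rightKanExtensionCounit F) (F.rightKanExtension F) ≫
      F.rightKanExtensionCounit F)

theorem codensityUnit_fac [F.HasRightKanExtension F] (X : A) :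
    (codensityUnit F).app (F.obj X) ≫ (F.rightKanExtensionCounit F).app X = 𝟙 (F.obj X) :=
  Functor.liftOfIsRightKanExtension_fac_app _ (F.rightKanExtensionCounit F) (𝟭 B)
    F.rightUnitor.hom X

theorem codensityMul_fac [F.HasRightKanExtension F] (X : A) :
    (codensityMul F).app (F.obj X) ≫ (F.rightKanExtensionCounit F).app X =
      (F.rightKanExtension F).map ((F.rightKanExtensionCounit F).app X) ≫
        (F.rightKanExtensionCounit F).app X :=
  (Functor.liftOfIsRightKanExtension_fac_app _ (F.rightKanExtensionCounit F)
    (F.rightKanExtension F ⋙ F.rightKanExtension F) _ X).trans (Category.id_comp _)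

theorem rightKan_hom_ext [F.HasRightKanExtension F] {G : B ⥤ B}
    (α β : ∀ X, G.obj X ⟶ (F.rightKanExtension F).obj X)
    (hα : ∀ ⦃X Y : B⦄ (f : X ⟶ Y), G.map f ≫ α Y = α X ≫ (F.rightKanExtension F).map f)
    (hβ : ∀ ⦃X Y : B⦄ (f : X ⟶ Y), G.map f ≫ β Y = β X ≫ (F.rightKanExtension F).map f)
    (h : ∀ a, α (F.obj a) ≫ (F.rightKanExtensionCounit F).app a =
      β (F.obj a) ≫ (F.rightKanExtensionCounit F).app a) (X : B) : α X = β X :=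
  NatTrans.congr_app (Functor.hom_ext_of_isRightKanExtension _ (F.rightKanExtensionCounit F)
    ({ app := α, naturality := hα } : G ⟶ _) { app := β, naturality := hβ }
    (by ext a; exact h a)) X

/-- The codensity monad of `F`: the right Kan extension of `F` along itself, with the unit and the
multiplication given by its universal property. -/
noncomputable def codensityMonad [F.HasRightKanExtension F] : Monad B where
  toFunctor := F.rightKanExtension F
  η := codensityUnit F
  μ := codensityMul F
  left_unit := by
    refine rightKan_hom_ext F (G := F.rightKanExtension F) _ _ ?_ ?_ ?_
    · intro X Y f
      have h₁ := (codensityUnit F).naturality ((F.rightKanExtension F).map f)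
      have h₂ := (codensityMul F).naturality f
      dsimp at h₁ h₂ ⊢
      rw [reassoc_of% h₁, h₂, Category.assoc]
    · simp
    · intro a
      have h := (codensityUnit F).naturality ((F.rightKanExtensionCounit F).app a)
      dsimp at h ⊢
      rw [Category.assoc, codensityMul_fac, ← reassoc_of% h, codensityUnit_fac,
        Category.comp_id, Category.id_comp]
  right_unit := by
    refine rightKan_hom_ext F (G := F.rightKanExtension F) _ _ ?_ ?_ ?_
    · intro X Y f
      have h₁ := (codensityUnit F).naturality f
      have h₂ := (codensityMul F).naturality f
      dsimp at h₁ h₂ ⊢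
      rw [← Functor.map_comp_assoc, h₁, Functor.map_comp_assoc, h₂, Category.assoc]
    · simp
    · intro a
      dsimp
      rw [Category.assoc, codensityMul_fac, ← Functor.map_comp_assoc, codensityUnit_fac,
        CategoryTheory.Functor.map_id]
  assoc := by
    refine rightKan_hom_ext F
      (G := F.rightKanExtension F ⋙ F.rightKanExtension F ⋙ F.rightKanExtension F) _ _ ?_ ?_ ?_
    · intro X Y f
      have h := (codensityMul F).naturality f
      dsimp at h ⊢
      rw [← Functor.map_comp_assoc, h, Functor.map_comp_assoc, h, Category.assoc]
    · intro X Y f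
      have h := (codensityMul F).naturality f
      have h' := (codensityMul F).naturality ((F.rightKanExtension F).map f)
      dsimp at h h' ⊢
      rw [reassoc_of% h', h, Category.assoc]
    · intro a
      have h := (codensityMul F).naturality ((F.rightKanExtensionCounit F).app a)
      dsimp at h ⊢
      rw [Category.assoc, Category.assoc, codensityMul_fac, ← Functor.map_comp_assoc,
        codensityMul_fac, ← reassoc_of% h, codensityMul_fac, Functor.map_comp_assoc]

/-- The counit of the density comonad of `F`, corresponding to the identity of `F` under the
universal property of the left Kan extension of `F` along itself. -/
noncomputable def densityCounit [F.HasLeftKanExtension F] : F.leftKanExtension F ⟶ 𝟭 B :=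
  Functor.descOfIsLeftKanExtension _ (F.leftKanExtensionUnit F) (𝟭 B) F.rightUnitor.inv

/-- The comultiplication of the density comonad of `F`. If `D` is the left Kan extension of `F`
along itself and `η : F ⟶ F ⋙ D` its unit, it corresponds to the composition
`F ⟶ F ⋙ D ⟶ F ⋙ D ⋙ D` of two instances of `η` under the universal property. -/
noncomputable def densityComul [F.HasLeftKanExtension F] :
    F.leftKanExtension F ⟶ F.leftKanExtension F ⋙ F.leftKanExtension F :=
  Functor.descOfIsLeftKanExtension _ (F.leftKanExtensionUnit F) _
    (F.leftKanExtensionUnit F ≫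
      Functor.whiskerRight (F.leftKanExtensionUnit F) (F.leftKanExtension F) ≫
      (Functor.associator _ _ _).hom)

theorem densityCounit_fac [F.HasLeftKanExtension F] (X : A) :
    (F.leftKanExtensionUnit F).app X ≫ (densityCounit F).app (F.obj X) = 𝟙 (F.obj X) :=
  Functor.descOfIsLeftKanExtension_fac_app _ (F.leftKanExtensionUnit F) (𝟭 B)
    F.rightUnitor.inv X

theorem densityComul_fac [F.HasLeftKanExtension F] (X : A) :
    (F.leftKanExtensionUnit F).app X ≫ (densityComul F).app (F.obj X) =
      (F.leftKanExtensionUnit F).app X ≫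
        (F.leftKanExtension F).map ((F.leftKanExtensionUnit F).app X) :=
  (Functor.descOfIsLeftKanExtension_fac_app _ (F.leftKanExtensionUnit F)
    (F.leftKanExtension F ⋙ F.leftKanExtension F) _ X).trans
    (congrArg _ (Category.comp_id _))

theorem leftKan_hom_ext [F.HasLeftKanExtension F] {G : B ⥤ B}
    (α β : ∀ X, (F.leftKanExtension F).obj X ⟶ G.obj X)
    (hα : ∀ ⦃X Y : B⦄ (f : X ⟶ Y), (F.leftKanExtension F).map f ≫ α Y = α X ≫ G.map f)
    (hβ : ∀ ⦃X Y : B⦄ (f : X ⟶ Y), (F.leftKanExtension F).map f ≫ β Y = β X ≫ G.map f)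
    (h : ∀ a, (F.leftKanExtensionUnit F).app a ≫ α (F.obj a) =
      (F.leftKanExtensionUnit F).app a ≫ β (F.obj a)) (X : B) : α X = β X :=
  NatTrans.congr_app (Functor.hom_ext_of_isLeftKanExtension _ (F.leftKanExtensionUnit F)
    ({ app := α, naturality := hα } : _ ⟶ G) { app := β, naturality := hβ }
    (by ext a; exact h a)) X

/-- The density comonad of `F`: the left Kan extension of `F` along itself, with the counit and the
comultiplication given by its universal property. -/
noncomputable def densityComonad [F.HasLeftKanExtension F] : Comonad B where
  toFunctor := F.leftKanExtension F
  ε := densityCounit F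
  δ := densityComul F
  left_counit := by
    refine leftKan_hom_ext F (G := F.leftKanExtension F) _ _ ?_ ?_ ?_
    · intro X Y f
      have h₁ := (densityCounit F).naturality ((F.leftKanExtension F).map f)
      have h₂ := (densityComul F).naturality f
      dsimp at h₁ h₂ ⊢
      rw [reassoc_of% h₂, h₁, Category.assoc]
    · simp
    · intro a
      have h := (densityCounit F).naturality ((F.leftKanExtensionUnit F).app a)
      have h' := densityComul_fac F a
      dsimp at h h' ⊢
      rw [reassoc_of% h', h, ← Category.assoc, densityCounit_fac,
        Category.comp_id, Category.id_comp]
  right_counit := by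
    refine leftKan_hom_ext F (G := F.leftKanExtension F) _ _ ?_ ?_ ?_
    · intro X Y f
      have h₁ := (densityCounit F).naturality f
      have h₂ := (densityComul F).naturality f
      dsimp at h₁ h₂ ⊢
      rw [reassoc_of% h₂, ← Functor.map_comp, h₁, Functor.map_comp, Category.assoc]
    · simp
    · intro a
      have h' := densityComul_fac F a
      dsimp at h' ⊢
      rw [reassoc_of% h', ← Functor.map_comp, densityCounit_fac, CategoryTheory.Functor.map_id]
  coassoc := by
    refine leftKan_hom_ext F
      (G := F.leftKanExtension F ⋙ F.leftKanExtension F ⋙ F.leftKanExtension F) _ _ ?_ ?_ ?_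
    · intro X Y f
      have h := (densityComul F).naturality f
      dsimp at h ⊢
      rw [reassoc_of% h, ← Functor.map_comp, h, Functor.map_comp, Category.assoc]
    · intro X Y f
      have h := (densityComul F).naturality f
      have h' := (densityComul F).naturality ((F.leftKanExtension F).map f)
      dsimp at h h' ⊢
      rw [reassoc_of% h, h', Category.assoc]
    · intro a
      have h := (densityComul F).naturality ((F.leftKanExtensionUnit F).app a)
      have h' := densityComul_fac F a
      dsimp at h h' ⊢
      rw [reassoc_of% h', reassoc_of% h', h, reassoc_of% h', ← Functor.map_comp,
        h', Functor.map_comp]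

end Kan

/-- The functor `F` preserves the limits of `κ`-codirected diagrams, that is of diagrams indexed by
`Jᵒᵖ` where `J` is a small `κ`-directed poset (one in which every subset with fewer than `κ`
elements has an upper bound). -/
def PreservesCardinalCodirectedLimits {C : Type u₁} [Category.{v₁} C] {D : Type u₂}
    [Category.{v₂} D] (F : C ⥤ D) (κ : Cardinal.{w}) [Fact κ.IsRegular] : Prop :=
  ∀ (J : Type w) [PartialOrder J] [IsCardinalFiltered J κ], PreservesLimitsOfShape Jᵒᵖ F

end CodensityAccess

/-! The functors `toInd` and `toPro` are fully faithful, so the codensity unit and the density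
counit are invertible on objects of `A`. If both conditions hold, they are invertible everywhere.
The unit then identifies the elements of an ind-object `P` over `B` with the natural families of
maps from `Hom(P, W)` to `Hom(B, W)`, for `W` in `A`; the counit says that elements of the functors
dual to pro-objects are separated by maps to representables.

These two facts force parallel maps `f, g : Y ⟶ X` to coincide. Let `Q` be the ind-object of
families in `X` indexed by a `κ`-directed linear order `J` and a point at infinity, eventually equal
to their value at infinity. By `exists_bound_of_isIso`, a map `h` from `Q` to a representable
depends only on the value at infinity and on the values up to some `j`. Hence `h` is eventually
constant along the families `r j` equal to `f` up to `j` and to `g` beyond. The eventual values are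
natural in `h`, so they come from an element `q` of `Q`. Evaluation shows that `q` is `f` at each
index and `g` at infinity; since `q` is eventually constant, `f = g`. -/

namespace CodensityAccess

open Opposite

section

variable {A : Type u₁} [Category.{v₁} A] {B : Type u₂} [Category.{v₂} B] (F : A ⥤ B)

/-! ### Objects at which the unit of the codensity monad is invertible -/

theorem isIso_codensityUnit_app_obj [F.Full] [F.Faithful] [F.HasPointwiseRightKanExtension F]
    (X : A) : IsIso ((codensityUnit F).app (F.obj X)) := by
  have : IsIso (F.rightKanExtensionCounit F) :=
    (Functor.isPointwiseRightKanExtensionOfIsRightKanExtension _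
      (F.rightKanExtensionCounit F)).isIso_hom
  have h := codensityUnit_fac F X
  exact IsIso.of_isIso_fac_right (hh := (inferInstance : IsIso (𝟙 (F.obj X)))) h

/-- The identity and the codensity monad both preserve the given colimit, so the unit at its vertex
is induced by the invertible units on the diagram. -/
theorem isIso_codensityUnit_app [F.Full] [F.Faithful] [F.HasPointwiseRightKanExtension F]
    {J : Type*} [Category J] [PreservesColimitsOfShape J (F.rightKanExtension F)] (D : J ⥤ A)
    {c : Cocone (D ⋙ F)} (hc : IsColimit c) : IsIso ((codensityUnit F).app c.pt) := by
  let τ := Functor.whiskerLeft (D ⋙ F) (codensityUnit F)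
  have : ∀ j, IsIso (τ.app j) := fun j => isIso_codensityUnit_app_obj F (D.obj j)
  have : IsIso τ := NatIso.isIso_of_isIso_app τ
  let hc' := isColimitOfPreserves (F.rightKanExtension F) hc
  have h : (codensityUnit F).app c.pt = (hc.coconePointsIsoOfNatIso hc' (asIso τ)).hom :=
    hc.hom_ext fun j => by
      rw [IsColimit.comp_coconePointsIsoOfNatIso_hom]
      exact (codensityUnit F).naturality (c.ι.app j)
  rw [h]
  infer_instance

theorem codensityUnit_app_comp [F.HasRightKanExtension F] {P : B} {W : A} (h : P ⟶ F.obj W) :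
    (codensityUnit F).app P ≫ (F.rightKanExtension F).map h ≫
      (F.rightKanExtensionCounit F).app W = h := by
  have h₁ := (codensityUnit F).naturality h
  dsimp at h₁
  rw [← reassoc_of% h₁, codensityUnit_fac, Category.comp_id]

/-- By the pointwise formula the value at `P` is a limit over the arrows from `P` to objects of `A`;
a natural family `s` is a cone over that diagram. -/
theorem exists_lift_rightKanExtension_obj [F.HasPointwiseRightKanExtension F] {P Z : B}
    (s : ∀ W, (P ⟶ F.obj W) → (Z ⟶ F.obj W))
    (hs : ∀ ⦃W W'⦄ (h : P ⟶ F.obj W) (m : W ⟶ W'), s W' (h ≫ F.map m) = s W h ≫ F.map m) :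
    ∃ t : Z ⟶ (F.rightKanExtension F).obj P, ∀ W h,
      t ≫ (F.rightKanExtension F).map h ≫ (F.rightKanExtensionCounit F).app W = s W h := by
  let hP := Functor.isPointwiseRightKanExtensionOfIsRightKanExtension _
      (F.rightKanExtensionCounit F) P
  let t : Cone (StructuredArrow.proj P F ⋙ F) :=
    { pt := Z
      π :=
        { app := fun g => s g.right g.hom
          naturality := fun g g' m => by
            have := hs g.hom m.right
            rw [StructuredArrow.w] at this
            exact (Category.id_comp _).trans this } }
  exact ⟨hP.lift t, fun W h => hP.fac t (StructuredArrow.mk h)⟩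

theorem rightKanExtension_obj_hom_ext [F.HasPointwiseRightKanExtension F] {P Z : B}
    {t t' : Z ⟶ (F.rightKanExtension F).obj P}
    (h : ∀ W (h : P ⟶ F.obj W),
      t ≫ (F.rightKanExtension F).map h ≫ (F.rightKanExtensionCounit F).app W =
        t' ≫ (F.rightKanExtension F).map h ≫ (F.rightKanExtensionCounit F).app W) : t = t' :=
  (Functor.isPointwiseRightKanExtensionOfIsRightKanExtension _
      (F.rightKanExtensionCounit F) P).hom_ext fun g => h _ g.hom

theorem exists_lift_of_isIso_codensityUnit [F.HasPointwiseRightKanExtension F] {P Z : B}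
    (hP : IsIso ((codensityUnit F).app P)) (s : ∀ W, (P ⟶ F.obj W) → (Z ⟶ F.obj W))
    (hs : ∀ ⦃W W'⦄ (h : P ⟶ F.obj W) (m : W ⟶ W'), s W' (h ≫ F.map m) = s W h ≫ F.map m) :
    ∃ q : Z ⟶ P, ∀ W h, q ≫ h = s W h := by
  obtain ⟨t, ht⟩ := exists_lift_rightKanExtension_obj F s hs
  obtain ⟨q, rfl⟩ : ∃ q, q ≫ (codensityUnit F).app P = t :=
    ⟨t ≫ inv ((codensityUnit F).app P : P ⟶ _), by
      rw [Category.assoc, IsIso.inv_hom_id]; exact Category.comp_id t⟩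
  refine ⟨q, fun W h => ?_⟩
  rw [← ht, Category.assoc, codensityUnit_app_comp]

theorem hom_ext_of_isIso_codensityUnit [F.HasPointwiseRightKanExtension F] {P Z : B}
    (hP : IsIso ((codensityUnit F).app P)) {q q' : Z ⟶ P}
    (h : ∀ W (h : P ⟶ F.obj W), q ≫ h = q' ≫ h) : q = q' := by
  rw [← cancel_mono ((codensityUnit F).app P)]
  refine rightKanExtension_obj_hom_ext F fun W g => ?_
  rw [Category.assoc, Category.assoc, codensityUnit_app_comp]
  exact h W g

/-! ### Objects at which the counit of the density comonad is invertible -/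

theorem isIso_densityCounit_app_obj [F.Full] [F.Faithful] [F.HasPointwiseLeftKanExtension F]
    (X : A) : IsIso ((densityCounit F).app (F.obj X)) := by
  have : IsIso (F.leftKanExtensionUnit F) :=
    (Functor.isPointwiseLeftKanExtensionOfIsLeftKanExtension _
      (F.leftKanExtensionUnit F)).isIso_hom
  have h := densityCounit_fac F X
  exact IsIso.of_isIso_fac_left h

theorem isIso_densityCounit_app [F.Full] [F.Faithful] [F.HasPointwiseLeftKanExtension F]
    {J : Type*} [Category J] [PreservesLimitsOfShape J (F.leftKanExtension F)] (D : J ⥤ A)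
    {c : Cone (D ⋙ F)} (hc : IsLimit c) : IsIso ((densityCounit F).app c.pt) := by
  let τ := Functor.whiskerLeft (D ⋙ F) (densityCounit F)
  have : ∀ j, IsIso (τ.app j) := fun j => isIso_densityCounit_app_obj F (D.obj j)
  have : IsIso τ := NatIso.isIso_of_isIso_app τ
  let hc' := isLimitOfPreserves (F.leftKanExtension F) hc
  have h : (densityCounit F).app c.pt = (hc'.conePointsIsoOfNatIso hc (asIso τ)).hom :=
    hc.hom_ext fun j => by
      rw [IsLimit.conePointsIsoOfNatIso_hom_comp]
      exact ((densityCounit F).naturality (c.π.app j)).symm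
  rw [h]
  infer_instance

theorem comp_densityCounit_app [F.HasLeftKanExtension F] {N : B} {W : A} (h : F.obj W ⟶ N) :
    (F.leftKanExtensionUnit F).app W ≫ (F.leftKanExtension F).map h ≫
      (densityCounit F).app N = h := by
  have h₁ := (densityCounit F).naturality h
  dsimp at h₁
  rw [h₁, ← Category.assoc, densityCounit_fac, Category.id_comp]

theorem leftKanExtension_obj_hom_ext [F.HasPointwiseLeftKanExtension F] {N Z : B}
    {t t' : (F.leftKanExtension F).obj N ⟶ Z}
    (h : ∀ W (h : F.obj W ⟶ N),
      ((F.leftKanExtensionUnit F).app W ≫ (F.leftKanExtension F).map h) ≫ t =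
        ((F.leftKanExtensionUnit F).app W ≫ (F.leftKanExtension F).map h) ≫ t') : t = t' :=
  (Functor.isPointwiseLeftKanExtensionOfIsLeftKanExtension _
      (F.leftKanExtensionUnit F) N).hom_ext fun g => h _ g.hom

/-- On the density side only this separation property is needed, not the existence of lifts. -/
theorem hom_ext_of_isIso_densityCounit [F.HasPointwiseLeftKanExtension F] {N Z : B}
    (hN : IsIso ((densityCounit F).app N)) {q q' : N ⟶ Z}
    (h : ∀ W (h : F.obj W ⟶ N), h ≫ q = h ≫ q') : q = q' := by
  rw [← cancel_epi ((densityCounit F).app N)]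
  refine leftKanExtension_obj_hom_ext F fun W g => ?_
  have := comp_densityCounit_app F g
  rw [← Category.assoc, ← Category.assoc, Category.assoc _ _ ((densityCounit F).app N), this]
  exact h W g

end

/-! ### Ind-objects as `κ`-continuous presheaves -/

section

variable {C : Type w} [SmallCategory C] (κ : Cardinal.{w})

/-- The cocone given by a compatible family of morphisms. -/
def coconeOfLegs {K : Type*} [Category K] {C : Type*} [Category C] {F : K ⥤ C} {X : C}
    (t : ∀ k, F.obj k ⟶ X) (ht : ∀ ⦃k k' : K⦄ (f : k ⟶ k'), F.map f ≫ t k' = t k) : Cocone F where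
  pt := X
  ι := { app := t, naturality := fun _ _ f => (ht f).trans (Category.comp_id _).symm }

/-- A presheaf is `κ`-continuous if it sends the colimits of diagrams with fewer than `κ` arrows
to limits. -/
def IsCardinalContinuous (P : Cᵒᵖ ⥤ Type w) : Prop :=
  ∀ ⦃K : Type w⦄ [SmallCategory K], HasCardinalLT (Arrow K) κ → ∀ ⦃F : K ⥤ C⦄ ⦃X : C⦄
    (t : ∀ k, F.obj k ⟶ X) (ht : ∀ ⦃k k'⦄ (f : k ⟶ k'), F.map f ≫ t k' = t k),
    IsColimit (coconeOfLegs t ht) → ∀ x : ∀ k, P.obj (op (F.obj k)),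
      (∀ ⦃k k'⦄ (f : k ⟶ k'), P.map (F.map f).op (x k') = x k) →
        ∃! y : P.obj (op X), ∀ k, P.map (t k).op y = x k

variable {κ}

theorem isCardinalContinuous_yoneda (X : C) : IsCardinalContinuous κ (yoneda.obj X) := by
  intro K _ _ F Y t ht hc x hx
  exact ⟨hc.desc (coconeOfLegs x hx), fun k => hc.fac (coconeOfLegs x hx) k,
    fun y hy => hc.hom_ext fun k => (hy k).trans (hc.fac (coconeOfLegs x hx) k).symm⟩

section

variable {J : Type w} [SmallCategory J] {D : J ⥤ Cᵒᵖ ⥤ Type w} {E : Cᵒᵖ ⥤ Type w}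

/-- Limits of size less than `κ` commute with `κ`-filtered colimits in sets. -/
theorem IsCardinalContinuous.of_filtered_family [Fact κ.IsRegular] [IsCardinalFiltered J κ]
    (hD : ∀ j, IsCardinalContinuous κ (D.obj j)) (ι : ∀ j, D.obj j ⟶ E)
    (hι : ∀ ⦃i j : J⦄ (f : i ⟶ j) (X : Cᵒᵖ) (x : (D.obj i).obj X),
      (ι j).app X ((D.map f).app X x) = (ι i).app X x)
    (hsurj : ∀ (X : Cᵒᵖ) (x : E.obj X), ∃ (j : J) (y : (D.obj j).obj X), (ι j).app X y = x)
    (hinj : ∀ (X : Cᵒᵖ) (j : J) (x y : (D.obj j).obj X), (ι j).app X x = (ι j).app X y →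
      ∃ (k : J) (f : j ⟶ k), (D.map f).app X x = (D.map f).app X y) :
    IsCardinalContinuous κ E := by
  have := isFiltered_of_isCardinalFiltered J κ
  intro K _ hK F T t ht hc x hx
  have hK' := hasCardinalLT_of_hasCardinalLT_arrow hK
  have hmap : ∀ ⦃i j k : J⦄ (f : i ⟶ j) (g : j ⟶ k) (X : Cᵒᵖ) (z : (D.obj i).obj X),
      (D.map g).app X ((D.map f).app X z) = (D.map (f ≫ g)).app X z :=
    fun i j k f g X z => by rw [D.map_comp]; rfl
  refine existsUnique_of_exists_of_unique ?_ ?_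
  · obtain ⟨m, y, hy⟩ : ∃ (m : J) (y : ∀ k, (D.obj m).obj (op (F.obj k))),
        ∀ k, (ι m).app _ (y k) = x k := by
      choose j y hy using fun k => hsurj _ (x k)
      exact ⟨_, fun k => (D.map (IsCardinalFiltered.toMax j hK' k)).app _ (y k),
        fun k => (hι _ _ _).trans (hy k)⟩
    have h₁ : ∀ φ : Arrow K, ∃ (n : J) (f : m ⟶ n),
        (D.map f).app _ ((D.obj m).map (F.map φ.hom).op (y φ.right)) =
          (D.map f).app _ (y φ.left) := fun φ => by
      refine hinj _ _ _ _ ?_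
      rw [NatTrans.naturality_apply, hy, hy, hx]
    choose n f hf using h₁
    -- The compatibility along each arrow of `K` holds at some later stage; there are fewer than `κ`
    -- arrows, so one stage `l` serves them all.
    obtain ⟨l, a, b, hab⟩ := IsCardinalFiltered.wideSpan f hK
    obtain ⟨z, hz, -⟩ := hD l hK t ht hc (fun k => (D.map b).app _ (y k)) (fun k k' φ => by
      have := congrArg ((D.map (a (Arrow.mk φ))).app _) (hf (Arrow.mk φ))
      rw [hmap, hmap, hab] at this
      rw [← NatTrans.naturality_apply]
      exact this)
    refine ⟨(ι l).app _ z, fun k => ?_⟩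
    rw [← NatTrans.naturality_apply, hz, hι, hy]
  · intro y₁ y₂ h₁ h₂
    obtain ⟨j, z₁, z₂, rfl, rfl⟩ : ∃ (j : J) (z₁ z₂ : (D.obj j).obj (op T)),
        (ι j).app _ z₁ = y₁ ∧ (ι j).app _ z₂ = y₂ := by
      obtain ⟨j₁, z₁, h₁⟩ := hsurj _ y₁
      obtain ⟨j₂, z₂, h₂⟩ := hsurj _ y₂
      exact ⟨_, (D.map (IsFiltered.leftToMax j₁ j₂)).app _ z₁,
        (D.map (IsFiltered.rightToMax j₁ j₂)).app _ z₂,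
        (hι _ _ _).trans h₁, (hι _ _ _).trans h₂⟩
    have h : ∀ k, ∃ (n : J) (f : j ⟶ n),
        (D.map f).app _ ((D.obj j).map (t k).op z₁) =
          (D.map f).app _ ((D.obj j).map (t k).op z₂) := fun k => by
      refine hinj _ _ _ _ ?_
      rw [NatTrans.naturality_apply, NatTrans.naturality_apply, h₁, h₂]
    choose n f hf using h
    obtain ⟨l, a, b, hab⟩ := IsCardinalFiltered.wideSpan f hK'
    have : (D.map b).app _ z₁ = (D.map b).app _ z₂ := by
      refine (hD l hK t ht hc (fun k => (D.obj l).map (t k).op ((D.map b).app _ z₁))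
        (fun k k' φ => ?_)).unique (fun k => rfl) (fun k => ?_)
      · rw [← comp_apply, ← Functor.map_comp, ← op_comp, ht]
      · have := congrArg ((D.map (a k)).app _) (hf k)
        rw [hmap, hmap, hab] at this
        rw [← NatTrans.naturality_apply, ← NatTrans.naturality_apply]
        exact this.symm
    rw [← hι b, this, hι]

theorem exists_ι_app_app_eq {c : Cocone D} (hc : IsColimit c) {X : Cᵒᵖ} (x : c.pt.obj X) :
    ∃ (j : J) (y : (D.obj j).obj X), (c.ι.app j).app X y = x :=
  Types.jointly_surjective_of_isColimit
    (isColimitOfPreserves ((evaluation Cᵒᵖ (Type w)).obj X) hc) x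

theorem IsCardinalContinuous.of_isColimit [Fact κ.IsRegular] [IsCardinalFiltered J κ]
    {c : Cocone D} (hc : IsColimit c) (hD : ∀ j, IsCardinalContinuous κ (D.obj j)) :
    IsCardinalContinuous κ c.pt :=
  have := isFiltered_of_isCardinalFiltered J κ
  .of_filtered_family hD c.ι.app (fun i j f X x => by rw [← c.w f]; rfl)
    (fun _ x => exists_ι_app_app_eq hc x) (fun X _ x y =>
      (Types.FilteredColimit.isColimit_eq_iff'
        (isColimitOfPreserves ((evaluation Cᵒᵖ (Type w)).obj X) hc) x y).1)

theorem IsCardinalContinuous.of_limit_family (hD : ∀ j, IsCardinalContinuous κ (D.obj j))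
    (π : ∀ j, E ⟶ D.obj j) (hπ : ∀ ⦃i j⦄ (f : i ⟶ j) (X : Cᵒᵖ) (z : E.obj X),
      (D.map f).app X ((π i).app X z) = (π j).app X z)
    (hE : ∀ (X : Cᵒᵖ) (x : ∀ j, (D.obj j).obj X),
      (∀ ⦃i j⦄ (f : i ⟶ j), (D.map f).app X (x i) = x j) →
        ∃! y : E.obj X, ∀ j, (π j).app X y = x j) : IsCardinalContinuous κ E := by
  intro K _ hK F T t ht hc x hx
  have hx' : ∀ j ⦃k k'⦄ (f : k ⟶ k'), (D.obj j).map (F.map f).op ((π j).app _ (x k')) =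
      (π j).app _ (x k) := fun j k k' f => by rw [← NatTrans.naturality_apply, hx]
  choose y hy hy' using fun j => hD j hK t ht hc (fun k => (π j).app _ (x k)) (hx' j)
  obtain ⟨z, hz, -⟩ := hE _ y fun i j f => hy' j _ fun k => by
    rw [← NatTrans.naturality_apply, hy, hπ]
  refine ⟨z, fun k => ?_, fun z' hz' => ?_⟩
  · refine (hE _ (fun j => (π j).app _ (x k))
      fun i j f => hπ f _ _).unique (fun j => ?_) fun j => rfl
    rw [NatTrans.naturality_apply, hz, hy]
  · refine (hE _ (fun j => (π j).app _ z)
      fun i j f => hπ f _ _).unique (fun j => ?_) fun j => rfl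
    rw [hz]
    exact hy' j _ fun k => by rw [← NatTrans.naturality_apply, hz']

theorem IsCardinalContinuous.of_isLimit {c : Cone D} (hc : IsLimit c)
    (hD : ∀ j, IsCardinalContinuous κ (D.obj j)) : IsCardinalContinuous κ c.pt :=
  .of_limit_family hD c.π.app (fun i j f X z => by rw [← c.w f]; rfl) fun X x hx =>
    (Types.isLimit_iff _).1 ⟨isLimitOfPreserves ((evaluation Cᵒᵖ (Type w)).obj X) hc⟩ x
      (fun f => hx f)

end

theorem isCardinalContinuous_of_isCardinalIndObject [Fact κ.IsRegular] {P : Cᵒᵖ ⥤ Type w}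
    (hP : isCardinalIndObject C κ P) : IsCardinalContinuous κ P := by
  obtain ⟨J, _, _, F, ι, ⟨h⟩⟩ := hP
  exact .of_isColimit h fun j => isCardinalContinuous_yoneda (F.obj j)

/-- In the category of elements, a small diagram is bounded by the colimit of its underlying
objects, with the element that continuity glues from the given ones. -/
theorem IsCardinalContinuous.isCardinalFiltered_costructuredArrow [Fact κ.IsRegular]
    (hC : IsCardinalCocomplete C κ) {P : Cᵒᵖ ⥤ Type w} (hP : IsCardinalContinuous κ P) :
    IsCardinalFiltered (CostructuredArrow yoneda P) κ where
  nonempty_cocone {K _} F hK := by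
    have := hC K hK
    let G := F ⋙ CostructuredArrow.proj yoneda P
    let t : ∀ k, (F.obj k).left ⟶ colimit G := colimit.ι G
    have ht : ∀ ⦃k k'⦄ (f : k ⟶ k'), (F.map f).left ≫ t k' = t k := fun k k' f => colimit.w G f
    obtain ⟨y, hy, -⟩ := hP hK (F := G) t ht (colimit.isColimit G)
      (fun k => yonedaEquiv (F.obj k).hom) (fun k k' f =>
        (yonedaEquiv_naturality _ _).trans
          (congrArg yonedaEquiv (CostructuredArrow.w (F.map f))))
    exact ⟨coconeOfLegs (X := CostructuredArrow.mk (yonedaEquiv.symm y))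
      (fun k => CostructuredArrow.homMk (t k) (by
        apply yonedaEquiv.injective
        refine (yonedaEquiv_naturality _ _).symm.trans ?_
        rw [CostructuredArrow.mk_hom_eq_self, Equiv.apply_symm_apply]
        exact hy k)) (fun k k' f => by ext; exact ht f)⟩

/-- A presheaf is the colimit of representables over its category of elements, which is `κ`-filtered
in the continuous case. -/
theorem isCardinalIndObject_iff [Fact κ.IsRegular] (hC : IsCardinalCocomplete C κ)
    (P : Cᵒᵖ ⥤ Type w) : isCardinalIndObject C κ P ↔ IsCardinalContinuous κ P :=
  ⟨isCardinalContinuous_of_isCardinalIndObject, fun hP =>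
    ⟨_, _, hP.isCardinalFiltered_costructuredArrow hC, _, _,
      ⟨Presheaf.isColimitTautologicalCocone P⟩⟩⟩

theorem IsCardinalComplete.op (h : IsCardinalComplete C κ) :
    IsCardinalCocomplete Cᵒᵖ κ := by
  intro K _ hK
  have := h Kᵒᵖ (by simpa using hK)
  infer_instance

theorem hasLimitsOfShape_indCompletion [Fact κ.IsRegular] (hC : IsCardinalCocomplete C κ)
    (K : Type w) [SmallCategory K] : HasLimitsOfShape K (IndCompletion C κ) := by
  have : (isCardinalIndObject C κ).IsClosedUnderLimitsOfShape K := ⟨by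
    rintro P ⟨h⟩
    exact (isCardinalIndObject_iff hC P).2 (.of_isLimit h.isLimit fun k =>
      isCardinalContinuous_of_isCardinalIndObject (h.prop_diag_obj k))⟩
  infer_instance

end

/-! ### Invertibility of the unit and counit on `Ind_κ A` and `Pro_κ A` -/

section

variable {A : Type w} [SmallCategory A] {κ : Cardinal.{w}} [Fact κ.IsRegular]

instance : (toInd A κ).Full := inferInstanceAs (ObjectProperty.lift _ _ _).Full

instance : (toInd A κ).Faithful := inferInstanceAs (ObjectProperty.lift _ _ _).Faithful

instance : (toPro A κ).Full := inferInstanceAs (toInd Aᵒᵖ κ).rightOp.Full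

instance : (toPro A κ).Faithful := inferInstanceAs (toInd Aᵒᵖ κ).rightOp.Faithful

theorem hasPointwiseRightKanExtension_toInd (h : IsCardinalCocomplete A κ) :
    (toInd A κ).HasPointwiseRightKanExtension (toInd A κ) := fun P =>
  have := hasLimitsOfShape_indCompletion h (StructuredArrow P (toInd A κ))
  inferInstance

theorem hasPointwiseLeftKanExtension_toPro (h : IsCardinalComplete A κ) :
    (toPro A κ).HasPointwiseLeftKanExtension (toPro A κ) := fun N =>
  have := hasLimitsOfShape_indCompletion h.op (CostructuredArrow (toPro A κ) N)ᵒᵖ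
  inferInstance

theorem exists_isColimit_toInd (P : IndCompletion A κ) :
    ∃ (J : Type w) (_ : SmallCategory J) (_ : IsCardinalFiltered J κ) (F : J ⥤ A)
      (c : Cocone (F ⋙ toInd A κ)), c.pt = P ∧ Nonempty (IsColimit c) := by
  obtain ⟨J, _, _, F, ι, ⟨h⟩⟩ := P.property
  let c : Cocone (F ⋙ toInd A κ) :=
    { pt := P
      ι :=
        { app := fun j => ObjectProperty.homMk (ι.app j)
          naturality := fun i j f => by ext : 1; exact ι.naturality f } }
  exact ⟨J, _, inferInstance, F, c, rfl, ⟨isColimitOfReflects (isCardinalIndObject A κ).ι h⟩⟩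

theorem isIso_codensityUnit_toInd [(toInd A κ).HasPointwiseRightKanExtension (toInd A κ)]
    (h : ((toInd A κ).rightKanExtension (toInd A κ)).IsCardinalAccessible κ)
    (P : IndCompletion A κ) : IsIso ((codensityUnit (toInd A κ)).app P) := by
  obtain ⟨J, _, _, F, c, rfl, ⟨hc⟩⟩ := exists_isColimit_toInd P
  have := h.preservesColimitOfShape J
  exact isIso_codensityUnit_app _ F hc

theorem isIso_densityCounit_toPro [(toPro A κ).HasPointwiseLeftKanExtension (toPro A κ)]
    (h : PreservesCardinalCodirectedLimits ((toPro A κ).leftKanExtension (toPro A κ)) κ)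
    (N : ProCompletion A κ) : IsIso ((densityCounit (toPro A κ)).app N) := by
  obtain ⟨J, _, _, F, c, hc, ⟨h'⟩⟩ := exists_isColimit_toInd N.unop
  obtain rfl : N = op c.pt := by rw [hc, op_unop]
  -- The hypothesis only concerns directed posets, so the filtered category is replaced by one along
  -- a final functor.
  obtain ⟨α, _, _, G, _⟩ := IsCardinalFiltered.exists_cardinal_directed J κ
  have := h α
  exact isIso_densityCounit_app (toPro A κ) (G ⋙ F).leftOp
    (c := (c.whisker G).op) ((Functor.Final.isColimitWhiskerEquiv G c).symm h').op

/-! ### Consequences for presheaves -/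

theorem exists_element_of_isIso_codensityUnit
    [(toInd A κ).HasPointwiseRightKanExtension (toInd A κ)] {P : Aᵒᵖ ⥤ Type w}
    (hP : isCardinalIndObject A κ P)
    (hP' : IsIso ((codensityUnit (toInd A κ)).app (⟨P, hP⟩ : IndCompletion A κ))) {B : A}
    (s : ∀ W, (P ⟶ yoneda.obj W) → (B ⟶ W))
    (hs : ∀ ⦃W W'⦄ (h : P ⟶ yoneda.obj W) (m : W ⟶ W'), s W' (h ≫ yoneda.map m) = s W h ≫ m) :
    ∃ x : P.obj (op B), ∀ W h, h.app (op B) x = s W h := by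
  obtain ⟨q, hq⟩ := exists_lift_of_isIso_codensityUnit (toInd A κ) hP' (Z := (toInd A κ).obj B)
    (fun W h => (toInd A κ).map (s W h.hom)) (fun W W' h m => by
      rw [← Functor.map_comp]
      exact congrArg _ (hs h.hom m))
  obtain ⟨q', hq'⟩ : ∃ q' : yoneda.obj B ⟶ P, ∀ W (h : P ⟶ yoneda.obj W),
      q' ≫ h = yoneda.map (s W h) :=
    ⟨q.hom, fun W h => congrArg (fun q => q.hom) (hq W (ObjectProperty.homMk h))⟩
  refine ⟨yonedaEquiv q', fun W h => ?_⟩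
  rw [← yonedaEquiv_comp, hq', yonedaEquiv_yoneda_map]

theorem element_ext_of_isIso_codensityUnit
    [(toInd A κ).HasPointwiseRightKanExtension (toInd A κ)] {P : Aᵒᵖ ⥤ Type w}
    (hP : isCardinalIndObject A κ P)
    (hP' : IsIso ((codensityUnit (toInd A κ)).app (⟨P, hP⟩ : IndCompletion A κ))) {B : A}
    {x y : P.obj (op B)} (h : ∀ W (h : P ⟶ yoneda.obj W), h.app (op B) x = h.app (op B) y) :
    x = y := by
  apply yonedaEquiv.symm.injective
  have h' : ∀ W (g : P ⟶ yoneda.obj W), yonedaEquiv.symm x ≫ g = yonedaEquiv.symm y ≫ g :=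
    fun W g => by rw [yonedaEquiv_symm_naturality_right, yonedaEquiv_symm_naturality_right, h]
  have := hom_ext_of_isIso_codensityUnit (toInd A κ) hP' (Z := (toInd A κ).obj B)
    (q := ObjectProperty.homMk (yonedaEquiv.symm x))
    (q' := ObjectProperty.homMk (yonedaEquiv.symm y)) (fun W g => by
      ext : 1
      exact h' W g.hom)
  exact congrArg (fun q => q.hom) this

theorem element_ext_of_isIso_densityCounit
    [(toPro A κ).HasPointwiseLeftKanExtension (toPro A κ)] {G : Aᵒᵖᵒᵖ ⥤ Type w}
    (hG : isCardinalIndObject Aᵒᵖ κ G)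
    (hG' : IsIso ((densityCounit (toPro A κ)).app (op ⟨G, hG⟩ : ProCompletion A κ))) {W : A}
    {x y : G.obj (op (op W))}
    (h : ∀ B (s : G ⟶ yoneda.obj (op B)), s.app (op (op W)) x = s.app (op (op W)) y) :
    x = y := by
  apply yonedaEquiv.symm.injective
  have h' : ∀ B (g : G ⟶ yoneda.obj (op B)),
      yonedaEquiv.symm x ≫ g = yonedaEquiv.symm y ≫ g :=
    fun B g => by rw [yonedaEquiv_symm_naturality_right, yonedaEquiv_symm_naturality_right, h]
  have := hom_ext_of_isIso_densityCounit (toPro A κ) hG' (Z := (toPro A κ).obj W)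
    (q := Quiver.Hom.op (ObjectProperty.homMk (yonedaEquiv.symm x)))
    (q' := Quiver.Hom.op (ObjectProperty.homMk (yonedaEquiv.symm y))) (fun B g => by
      apply Quiver.Hom.unop_inj
      ext : 1
      exact h' B g.unop.hom)
  exact congrArg (fun q => q.unop.hom) this

end

/-! ### The functor dual to a presheaf, and agreement presheaves -/

section

variable {A : Type w} [SmallCategory A] {κ : Cardinal.{w}}

/-- The presheaf of morphisms from `P` to representable presheaves is `κ`-continuous. -/
theorem isCardinalContinuous_hom (P : Aᵒᵖ ⥤ Type w) :
    IsCardinalContinuous κ (unopUnop A ⋙ yoneda ⋙ coyoneda.obj (op P)) := by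
  intro K _ _ F T t ht hc x hx
  let x' : ∀ k, P ⟶ yoneda.obj (F.obj k).unop := x
  have hx' : ∀ ⦃k k'⦄ (f : k ⟶ k'), x' k' ≫ yoneda.map (F.map f).unop = x' k := hx
  -- Gluing is done one element `p` at a time: the values at `p` form a cocone in `Aᵒᵖ`.
  let s : ∀ (B : Aᵒᵖ) (p : P.obj B), Cocone F := fun B p =>
    coconeOfLegs (X := B) (fun k => ((x' k).app B p).op) fun k k' f => by
      rw [← hx' f]; rfl
  have hs : ∀ B p k, t k ≫ hc.desc (s B p) = ((x' k).app B p).op := fun B p k =>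
    hc.fac (s B p) k
  refine ⟨({ app := fun B => ↾fun p => (hc.desc (s B p)).unop
             naturality := fun B B' f => ?_ } : P ⟶ yoneda.obj T.unop), fun k => ?_,
    fun y hy => ?_⟩
  · ext p
    apply Quiver.Hom.op_inj
    refine hc.hom_ext fun k => ?_
    refine (hs _ _ k).trans ?_
    refine Eq.trans ?_ ((congrArg (· ≫ f) (hs B p k).symm).trans (Category.assoc _ _ _))
    exact congrArg Quiver.Hom.op (NatTrans.naturality_apply (x' k) f p)
  · show _ = x' k
    ext B p
    exact congrArg Quiver.Hom.unop (hs B p k)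
  · let y' : P ⟶ yoneda.obj T.unop := y
    have hy' : ∀ k, y' ≫ yoneda.map (t k).unop = x' k := hy
    show y' = _
    ext B p
    apply Quiver.Hom.op_inj
    refine hc.hom_ext fun k => (Eq.trans ?_ (hs B p k).symm)
    rw [← hy']
    rfl

variable {J : Type w} [LinearOrder J]

/-- The families of morphisms to `X` indexed by two copies of `J` and an additional point, which
are eventually equal to their value at that point, and take the same value on both copies of the
elements of `S`. -/
def agreementPresheaf (X : A) (S : Set J) : Aᵒᵖ ⥤ Type w where
  obj B := { x : Option (J × Bool) → (B.unop ⟶ X) //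
    (∃ b, ∀ i, b ≤ i → ∀ ε, x (some (i, ε)) = x none) ∧
      ∀ i ∈ S, x (some (i, false)) = x (some (i, true)) }
  map f := ↾fun x => ⟨fun o => f.unop ≫ x.1 o,
    x.2.1.imp fun _ hb i hi ε => congrArg (f.unop ≫ ·) (hb i hi ε),
    fun i hi => congrArg (f.unop ≫ ·) (x.2.2 i hi)⟩
  map_id B := by
    ext x; exact Category.id_comp _
  map_comp f g := by
    ext x; exact Category.assoc _ _ _

/-- Families glue componentwise; the fewer than `κ` thresholds have a common upper bound in `J`. -/
theorem isCardinalContinuous_agreementPresheaf [Fact κ.IsRegular] [IsCardinalFiltered J κ]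
    (X : A) (S : Set J) : IsCardinalContinuous κ (agreementPresheaf X S) := by
  intro K _ hK F T t ht hc x hx
  choose b hb using fun k => (x k).2.1
  have hK' := hasCardinalLT_of_hasCardinalLT_arrow hK
  have hx' : ∀ o ⦃k k'⦄ (f : k ⟶ k'), F.map f ≫ (x k').1 o = (x k).1 o := fun o k k' f =>
    congrFun (congrArg Subtype.val (hx f)) o
  have hfac : ∀ o k, t k ≫ hc.desc (coconeOfLegs (fun k => (x k).1 o) (hx' o)) = (x k).1 o :=
    fun o k => hc.fac (coconeOfLegs (fun k => (x k).1 o) (hx' o)) k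
  refine ⟨⟨fun o => hc.desc (coconeOfLegs (fun k => (x k).1 o) (hx' o)),
    ⟨IsCardinalFiltered.max b hK', fun i hi ε => hc.hom_ext fun k => ?_⟩,
    fun i hi => hc.hom_ext fun k => ?_⟩, fun k => Subtype.ext (funext fun o => hfac o k),
    fun y hy => Subtype.ext (funext fun o => hc.hom_ext fun k => ?_)⟩
  · refine (hfac _ k).trans (Eq.trans ?_ (hfac _ k).symm)
    exact hb k i ((leOfHom (IsCardinalFiltered.toMax b hK' k)).trans hi) ε
  · exact (hfac _ k).trans (((x k).2.2 i hi).trans (hfac _ k).symm)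
  · exact (congrFun (congrArg Subtype.val (hy k)) o).trans (hfac o k).symm

/-- The inclusion of agreement presheaves. -/
def agreementInclusion (X : A) {S S' : Set J} (h : S' ⊆ S) :
    agreementPresheaf X S ⟶ agreementPresheaf X S' where
  app _ := ↾fun x => ⟨x.1, x.2.1, fun i hi => x.2.2 i (h hi)⟩

/-- The projections from agreement presheaves. -/
def agreementProjection (X : A) (S : Set J) (ε : Bool) :
    agreementPresheaf X S ⟶ agreementPresheaf X (Set.univ : Set J) where
  app _ := ↾fun x => ⟨fun o => x.1 (o.map fun p => (p.1, ε)),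
    x.2.1.imp fun _ hb i hi _ => hb i hi ε, fun _ _ => rfl⟩

/-- The evaluation of an agreement presheaf at an index. -/
def agreementEval (X : A) (S : Set J) (o : Option (J × Bool)) :
    agreementPresheaf X S ⟶ yoneda.obj X where
  app _ := ↾fun x => x.1 o

/-- Agreement presheaves as a functor of the set `Set.Iic i`. -/
def agreementFunctor (J : Type w) [LinearOrder J] (X : A) : J ⥤ (Aᵒᵖ ⥤ Type w)ᵒᵖ where
  obj i := op (agreementPresheaf X (Set.Iic i))
  map f := (agreementInclusion X (Set.Iic_subset_Iic.2 (leOfHom f))).op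

/-- A pair of eventually constant families which agree on `S` and at the additional point. -/
def agreementPair (X : A) (S : Set J) {B : Aᵒᵖ}
    (u v : (agreementPresheaf X (Set.univ : Set J)).obj B)
    (hS : ∀ i ∈ S, u.1 (some (i, false)) = v.1 (some (i, false))) (h : u.1 none = v.1 none) :
    (agreementPresheaf X S).obj B :=
  ⟨fun o => o.elim (u.1 none) fun p => cond p.2 (v.1 (some (p.1, false))) (u.1 (some (p.1, false))),
    by
      obtain ⟨b, hb⟩ := u.2.1
      obtain ⟨c, hc⟩ := v.2.1
      refine ⟨max b c, fun i hi ε => ?_⟩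
      cases ε
      · exact hb i ((le_max_left _ _).trans hi) _
      · exact (hc i ((le_max_right _ _).trans hi) _).trans h.symm,
    fun i hi => hS i hi⟩

theorem agreementProjection_false_agreementPair (X : A) (S : Set J) {B : Aᵒᵖ}
    (u v : (agreementPresheaf X (Set.univ : Set J)).obj B)
    (hS : ∀ i ∈ S, u.1 (some (i, false)) = v.1 (some (i, false))) (h : u.1 none = v.1 none) :
    (agreementProjection X S false).app B (agreementPair X S u v hS h) = u := by
  refine Subtype.ext (funext fun o => ?_)
  rcases o with _ | ⟨i, _ | _⟩
  · rfl
  · rfl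
  · exact u.2.2 i trivial

theorem agreementProjection_true_agreementPair (X : A) (S : Set J) {B : Aᵒᵖ}
    (u v : (agreementPresheaf X (Set.univ : Set J)).obj B)
    (hS : ∀ i ∈ S, u.1 (some (i, false)) = v.1 (some (i, false))) (h : u.1 none = v.1 none) :
    (agreementProjection X S true).app B (agreementPair X S u v hS h) = v := by
  refine Subtype.ext (funext fun o => ?_)
  rcases o with _ | ⟨i, _ | _⟩
  · exact h
  · rfl
  · exact v.2.2 i trivial

end

/-! ### Maps from `Q` to representables, and thinness -/

section

variable {A : Type w} [SmallCategory A] {κ : Cardinal.{w}} [Fact κ.IsRegular]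

/-- The presheaves `K j` of pairs of families agreeing up to `j` and at infinity decrease to the
diagonal. Passing to the colimit of their duals, the counit hypothesis makes the two projections
composed with `h` equal there, hence already equal on some `K j`. -/
theorem exists_bound_of_isIso (hlim : IsCardinalComplete A κ) (hcolim : IsCardinalCocomplete A κ)
    [(toInd A κ).HasPointwiseRightKanExtension (toInd A κ)]
    [(toPro A κ).HasPointwiseLeftKanExtension (toPro A κ)]
    (hT : ∀ P : IndCompletion A κ, IsIso ((codensityUnit (toInd A κ)).app P))
    (hD : ∀ N : ProCompletion A κ, IsIso ((densityCounit (toPro A κ)).app N))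
    {J : Type w} [LinearOrder J] [IsCardinalFiltered J κ] {X W : A}
    (h : agreementPresheaf X (Set.univ : Set J) ⟶ yoneda.obj W) :
    ∃ j : J, ∀ (B : Aᵒᵖ) (u v : (agreementPresheaf X (Set.univ : Set J)).obj B),
      (∀ i ≤ j, u.1 (some (i, false)) = v.1 (some (i, false))) → u.1 none = v.1 none →
        h.app B u = h.app B v := by
  have hJ := isFiltered_of_isCardinalFiltered J κ
  have hK : ∀ S : Set J, isCardinalIndObject A κ (agreementPresheaf X S) := fun S =>
    (isCardinalIndObject_iff hcolim _).2 (isCardinalContinuous_agreementPresheaf X S)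
  let D : J ⥤ Aᵒᵖᵒᵖ ⥤ Type w := agreementFunctor J X ⋙ coyoneda ⋙
    (Functor.whiskeringLeft _ _ _).obj (unopUnop A ⋙ yoneda)
  have hG : isCardinalIndObject Aᵒᵖ κ (colimit D) :=
    (isCardinalIndObject_iff hlim.op _).2
      (.of_isColimit (colimit.isColimit D) fun j => isCardinalContinuous_hom _)
  let ι : ∀ (j : J) (W : A), (agreementPresheaf X (Set.Iic j) ⟶ yoneda.obj W) →
    (colimit D).obj (op (op W)) := fun j W φ => (colimit.ι D j).app (op (op W)) φ
  have hι : ∀ (j : J) ⦃W W' : A⦄ (m : W ⟶ W') φ,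
      ι j W' (φ ≫ yoneda.map m) = (colimit D).map m.op.op (ι j W φ) := fun j W W' m φ =>
    NatTrans.naturality_apply (colimit.ι D j) m.op.op φ
  have hι' : ∀ ⦃i j : J⦄ (hij : i ≤ j) (W : A) φ,
      ι j W (agreementInclusion X (Set.Iic_subset_Iic.2 hij) ≫ φ) = ι i W φ :=
    fun i j hij W φ => by
      show _ = (colimit.ι D i).app (op (op W)) φ
      rw [← colimit.w D (homOfLE hij)]
      rfl
  obtain ⟨j₀⟩ : Nonempty J := hJ.nonempty
  have key : ι j₀ W (agreementProjection X _ false ≫ h) =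
      ι j₀ W (agreementProjection X _ true ≫ h) := by
    refine element_ext_of_isIso_densityCounit hG (hD _) fun B s => ?_
    let s' : ∀ (j : J) (W : A), (agreementPresheaf X (Set.Iic j) ⟶ yoneda.obj W) → (B ⟶ W) :=
      fun j W φ => Quiver.Hom.unop (s.app (op (op W)) (ι j W φ))
    -- A test map `s` out of the colimit restricts to a natural family on the dual of each `K j`,
    -- thus to an element of `K j` over `B`.
    choose k hk using fun j => exists_element_of_isIso_codensityUnit (hK (Set.Iic j)) (hT _)
      (B := B) (s' j) (fun W W' φ m => by
        show Quiver.Hom.unop (s.app (op (op W')) (ι j W' (φ ≫ yoneda.map m))) = _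
        rw [hι, NatTrans.naturality_apply]
        rfl)
    have hkk : ∀ ⦃i j : J⦄ (hij : i ≤ j),
        (agreementInclusion X (Set.Iic_subset_Iic.2 hij)).app (op B) (k j) = k i :=
      fun i j hij => element_ext_of_isIso_codensityUnit (hK (Set.Iic i)) (hT _) fun W φ => by
        rw [hk i]
        refine (hk j W (agreementInclusion X (Set.Iic_subset_Iic.2 hij) ≫ φ)).trans ?_
        exact congrArg (fun γ => Quiver.Hom.unop (s.app (op (op W)) γ)) (hι' hij W φ)
    -- The element at `j₀` also comes from the one at `max j₀ i`, whose two copies agree at `i`; so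
    -- it is diagonal.
    have hk₀ : ∀ i, (k j₀).1 (some (i, false)) = (k j₀).1 (some (i, true)) := fun i => by
      rw [← hkk (le_max_left j₀ i)]
      exact (k (max j₀ i)).2.2 i (le_max_right j₀ i)
    have hp : (agreementProjection X _ false).app (op B) (k j₀) =
        (agreementProjection X _ true).app (op B) (k j₀) := by
      refine Subtype.ext (funext fun o => ?_)
      rcases o with _ | ⟨i, ε⟩
      · rfl
      · exact hk₀ i
    apply Quiver.Hom.unop_inj
    refine (hk j₀ W _).symm.trans (Eq.trans ?_ (hk j₀ W _))
    exact congrArg (h.app (op B)) hp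
  -- Equality in a filtered colimit of sets is attained at some stage.
  obtain ⟨j, f, hf⟩ := (Types.FilteredColimit.isColimit_eq_iff'
    (isColimitOfPreserves ((evaluation Aᵒᵖᵒᵖ (Type w)).obj (op (op W)))
      (colimit.isColimit D)) _ _).1 key
  have hf' : agreementInclusion X (Set.Iic_subset_Iic.2 (leOfHom f)) ≫
        agreementProjection X _ false ≫ h =
      agreementInclusion X (Set.Iic_subset_Iic.2 (leOfHom f)) ≫
        agreementProjection X _ true ≫ h := hf
  refine ⟨j, fun B u v huv h₀ => ?_⟩
  have := congrArg (fun φ => φ.app B (agreementPair X (Set.Iic j) u v huv h₀)) hf'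
  exact (congrArg (h.app B) (agreementProjection_false_agreementPair X _ u v huv h₀)).symm.trans
    (this.trans (congrArg (h.app B) (agreementProjection_true_agreementPair X _ u v huv h₀)))

/-- The family which is equal to `f` up to `j`, and to `g` elsewhere. -/
def stepElement {J : Type w} [LinearOrder J] [NoMaxOrder J] {X Y : A} (f g : Y ⟶ X) (j : J) :
    (agreementPresheaf X (Set.univ : Set J)).obj (op Y) :=
  ⟨fun o => o.elim g fun p => if p.1 ≤ j then f else g, by
    obtain ⟨b, hb⟩ := exists_gt j
    exact ⟨b, fun i hi _ => if_neg (not_le.2 (hb.trans_le hi))⟩, fun _ _ => rfl⟩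

theorem isThin_of_isIso (hlim : IsCardinalComplete A κ) (hcolim : IsCardinalCocomplete A κ)
    [(toInd A κ).HasPointwiseRightKanExtension (toInd A κ)]
    [(toPro A κ).HasPointwiseLeftKanExtension (toPro A κ)]
    (hT : ∀ P : IndCompletion A κ, IsIso ((codensityUnit (toInd A κ)).app P))
    (hD : ∀ N : ProCompletion A κ, IsIso ((densityCounit (toPro A κ)).app N)) :
    Quiver.IsThin A := by
  refine fun Y X => ⟨fun f g => ?_⟩
  -- Regularity makes this order `κ`-directed; having no greatest element, it has indices beyond
  -- each `j`, as `stepElement` requires.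
  let J := κ.ord.ToType
  have : NoMaxOrder J := Cardinal.noMaxOrder (Cardinal.IsRegular.aleph0_le Fact.out)
  let Q : Aᵒᵖ ⥤ Type w := agreementPresheaf X (Set.univ : Set J)
  have hQ : isCardinalIndObject A κ Q :=
    (isCardinalIndObject_iff hcolim _).2 (isCardinalContinuous_agreementPresheaf X _)
  let r : J → Q.obj (op Y) := stepElement f g
  have hr : ∀ W (h : Q ⟶ yoneda.obj W), ∃ j₀, ∀ j, j₀ ≤ j →
      h.app (op Y) (r j) = h.app (op Y) (r j₀) := fun W h => by
    obtain ⟨j₀, hj₀⟩ := exists_bound_of_isIso hlim hcolim hT hD h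
    refine ⟨j₀, fun j hj => hj₀ _ _ _ (fun i hi => ?_) rfl⟩
    exact (if_pos (hi.trans hj)).trans (if_pos hi).symm
  choose b hb using hr
  -- The eventual values are natural: both thresholds may be replaced by their maximum.
  obtain ⟨q, hq⟩ := exists_element_of_isIso_codensityUnit hQ (hT _) (B := Y)
    (fun W h => h.app (op Y) (r (b W h))) (fun W W' h m => by
      have h₁ := hb W' (h ≫ yoneda.map m) (max (b W h) (b W' (h ≫ yoneda.map m)))
        (le_max_right _ _)
      have h₂ := hb W h (max (b W h) (b W' (h ≫ yoneda.map m))) (le_max_left _ _)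
      exact h₁.symm.trans (congrArg (fun x : Y ⟶ W => x ≫ m) h₂))
  have hq' : ∀ o j, b X (agreementEval X _ o) ≤ j → q.1 o = (r j).1 o := fun o j hj =>
    (hq X (agreementEval X _ o)).trans (hb X (agreementEval X _ o) j hj).symm
  have hnone : q.1 none = g := hq' none _ le_rfl
  -- The step is taken past both the threshold and `i`, where the family still equals `f` at `i`.
  have hsome : ∀ i, q.1 (some (i, false)) = f := fun i =>
    (hq' (some (i, false)) _ (le_max_left _ i)).trans (if_pos (le_max_right _ i))
  obtain ⟨i, hi⟩ := q.2.1
  exact ((hsome i).symm.trans (hi i le_rfl false)).trans hnone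

end

end CodensityAccess

theorem mainTheorem7 (A : Type w) [SmallCategory A] (κ : Cardinal.{w}) [Fact κ.IsRegular]
    (hlim : CodensityAccess.IsCardinalComplete A κ)
    (hcolim : CodensityAccess.IsCardinalCocomplete A κ)
    (hthin : ¬ Quiver.IsThin A) :
    ∃ (_ : (CodensityAccess.toInd A κ).HasRightKanExtension (CodensityAccess.toInd A κ))
      (_ : (CodensityAccess.toPro A κ).HasLeftKanExtension (CodensityAccess.toPro A κ)),
      ¬ ((CodensityAccess.codensityMonad
            (CodensityAccess.toInd A κ)).toFunctor.IsCardinalAccessible κ ∧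
          CodensityAccess.PreservesCardinalCodirectedLimits
            (CodensityAccess.densityComonad (CodensityAccess.toPro A κ)).toFunctor κ) := by
  have := CodensityAccess.hasPointwiseRightKanExtension_toInd hcolim
  have := CodensityAccess.hasPointwiseLeftKanExtension_toPro hlim
  exact ⟨inferInstance, inferInstance, fun ⟨hT, hD⟩ => hthin
    (CodensityAccess.isThin_of_isIso hlim hcolim
      (CodensityAccess.isIso_codensityUnit_toInd hT)
      (CodensityAccess.isIso_densityCounit_toPro hD))⟩
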